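/- Online Unit Clustering in $\mathbb{R}^d$ under the $L_\infty$ norm: the points of a finite nonempty set arrive one by one, and each point must, on arrival, be assigned irrevocably to an existing cluster or to a new one, so that every cluster always has $L_\infty$-diameter at most $1$; the cost is the number of clusters created. For an input sequence $\sigma$, let $\mathrm{OPT}(\sigma)$ be the minimum number of clusters in a partition of the points of $\sigma$ into clusters of $L_\infty$-diameter at most $1$. The competitive ratio of a deterministic online algorithm is $\sup_\sigma \mathrm{ALG}(\sigma)/\mathrm{OPT}(\sigma)$, and that of a randomized online algorithm is $\sup_\sigma \mathbb{E}[\mathrm{ALG}(\sigma)]/\mathrm{OPT}(\sigma)$ (either may be infinite). Theorem. There is an absolute constant $c>0$ such that for every integer $d\ge 1$: (i) every deterministic online algorithm for Unit Clustering in $\mathbb{R}^d$ under the $L_\infty$ norm has competitive ratio at least $c\,d$; the same bound holds for its ratio against deterministic adaptive adversaries, i.e. for the supremum of $\mathrm{ALG}(\sigma)/\mathrm{OPT}(\sigma)$ over all deterministic adversaries that choose each next point (or stop) from the points presented so far and the algorithm's decisions on them, and that stop after finitely many points, $\sigma$ being the resulting sequence; (ii) every randomized online algorithm for Unit Clustering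 in $\mathbb{R}^d$ under the $L_\infty$ norm has competitive ratio at least $c\,d$; the same bound holds for its ratio against randomized oblivious adversaries, i.e. for the supremum of $\mathbb{E}[\mathrm{ALG}(\sigma)]/\mathbb{E}[\mathrm{OPT}(\sigma)]$ over all discrete probability distributions of the input sequence $\sigma$, drawn independently of the random choices of the algorithm. -/

import Mathlib

open MeasureTheory
open scoped ENNReal

noncomputable section

namespace UnitClustering

/-- Points of `ℝ^d`; the distance on this type is the `L_∞` distance. -/
abbrev Point (d : ℕ) : Type := Fin d → ℝ

/-- A labelling `f` of a finite sequence of points describes a partition into clusters: `i` and `j`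
lie in the same cluster iff `f i = f j`. It is a unit clustering when every cluster has `L_∞`
diameter at most one. -/
def IsUnitClustering {d n : ℕ} (p : Fin n → Point d) (f : Fin n → ℕ) : Prop :=
  ∀ i j, f i = f j → dist (p i) (p j) ≤ 1

/-- The number of (nonempty) clusters of a labelling. -/
def numClusters {n : ℕ} (f : Fin n → ℕ) : ℕ := (Finset.univ.image f).card

/-- The offline optimum: the least number of clusters in a unit clustering of the sequence. -/
def opt {d : ℕ} (σ : List (Point d)) : ℕ :=
  sInf {k | ∃ f : Fin σ.length → ℕ, IsUnitClustering σ.get f ∧ numClusters f = k}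

/-- An input of the online problem: a finite nonempty set of points, arriving one by one in the
order of the list. -/
def IsInput {d : ℕ} (σ : List (Point d)) : Prop := σ ≠ [] ∧ σ.Nodup

/-- A deterministic online algorithm. When the points `p₁, …, pᵢ` have arrived, the point `pᵢ` is
put irrevocably into the cluster named `assign [p₁, …, pᵢ]`, which is either an existing cluster
(the name was used before) or a new one. On every input all clusters must have `L_∞` diameter at
most one. -/
structure OnlineAlgorithm (d : ℕ) where
  assign : List (Point d) → ℕ
  valid : ∀ σ : List (Point d), IsInput σ →
    IsUnitClustering σ.get (fun i : Fin σ.length => assign (σ.take (i + 1)))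

namespace OnlineAlgorithm

variable {d : ℕ} (A : OnlineAlgorithm d)

/-- The name of the cluster into which the algorithm puts the `i`-th point of `σ`. -/
def label (σ : List (Point d)) (i : Fin σ.length) : ℕ := A.assign (σ.take (i + 1))

/-- The number of clusters that the algorithm creates on `σ`. -/
def cost (σ : List (Point d)) : ℕ := numClusters (A.label σ)

/-- The competitive ratio `sup_σ ALG(σ) / OPT(σ)`. -/
def competitiveRatio : ℝ≥0∞ :=
  ⨆ (σ : List (Point d)) (_ : IsInput σ), (A.cost σ : ℝ≥0∞) / (opt σ : ℝ≥0∞)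

/-- Everything that has happened while the algorithm served `σ`: the points in order of arrival,
each with the cluster into which it was put. -/
def transcript (σ : List (Point d)) : List (Point d × ℕ) :=
  List.ofFn fun i : Fin σ.length => (σ.get i, A.label σ i)

end OnlineAlgorithm

/-- A deterministic adaptive adversary: from the points presented so far and the decisions of the
algorithm on them, it determines the next point, or stops (`none`). -/
abbrev AdaptiveAdversary (d : ℕ) : Type := List (Point d × ℕ) → Option (Point d)

namespace OnlineAlgorithm

variable {d : ℕ} (A : OnlineAlgorithm d)

/-- The points presented by the adversary `B` to the algorithm in its first `n` moves. -/
def play (B : AdaptiveAdversary d) : ℕ → List (Point d)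
  | 0 => []
  | n + 1 => play B n ++ (B (A.transcript (play B n))).toList

/-- The competitive ratio against deterministic adaptive adversaries: the supremum of
`ALG(σ) / OPT(σ)` over all adversaries that, playing against this algorithm, stop after finitely
many moves with a sequence `σ` that is an input. -/
def adaptiveRatio : ℝ≥0∞ :=
  ⨆ (B : AdaptiveAdversary d) (n : ℕ) (_ : B (A.transcript (A.play B n)) = none)
    (_ : IsInput (A.play B n)), (A.cost (A.play B n) : ℝ≥0∞) / (opt (A.play B n) : ℝ≥0∞)

end OnlineAlgorithm

/-- A randomized online algorithm with random source `Ω`: a probability distribution on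
deterministic online algorithms, such that every single decision is a random variable. -/
structure RandomizedAlgorithm (d : ℕ) (Ω : Type*) [MeasurableSpace Ω] where
  prob : Measure Ω
  isProb : IsProbabilityMeasure prob
  run : Ω → OnlineAlgorithm d
  measurable_assign : ∀ σ : List (Point d), Measurable fun ω => (run ω).assign σ

namespace RandomizedAlgorithm

variable {d : ℕ} {Ω : Type*} [MeasurableSpace Ω] (R : RandomizedAlgorithm d Ω)

/-- The expected number of clusters that the algorithm creates on `σ`. -/
def expectedCost (σ : List (Point d)) : ℝ≥0∞ := ∫⁻ ω, ((R.run ω).cost σ : ℝ≥0∞) ∂(R.prob)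

/-- The competitive ratio `sup_σ E[ALG(σ)] / OPT(σ)`. -/
def competitiveRatio : ℝ≥0∞ :=
  ⨆ (σ : List (Point d)) (_ : IsInput σ), R.expectedCost σ / (opt σ : ℝ≥0∞)

/-- The competitive ratio against randomized oblivious adversaries. Such an adversary draws the
whole input from a distribution `D`, independently of the random choices of the algorithm. -/
def obliviousRatio : ℝ≥0∞ :=
  ⨆ D : PMF {σ : List (Point d) // IsInput σ},
    (∑' σ, D σ * R.expectedCost σ.1) / (∑' σ, D σ * (opt σ.1 : ℝ≥0∞))

end RandomizedAlgorithm

end UnitClustering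

end

/-! The bound is proved against a random input with independent fair bits `v j`. Bit `j` chooses one
of two ways, shifted by one unit, of pairing consecutive grid values of coordinate `j` into cells.
Round `i` replaces the first `i` coordinates by midpoints of the chosen pairs, leaving the others on
the grid, so only the first `i` bits are revealed by then. With `2 * n - 1` grid values per
coordinate, either pairing has `n` cells, and one cluster per box of cells gives OPT at most `n ^
d`.

An online algorithm does not know the later bits. A cluster using two values of coordinate `i` is
split by one value of bit `i`, and is then too far from every later midpoint to receive points; a
cluster using one value wastes half of its room. `potential` balances the two risks:
`potential_step` shows that, averaged over bit `i`, it grows by at least the weighted number of new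
points. Hence a label collects expected load at most 3 times the probability that it is used. Each
of the `d + 1` rounds has weight at least `d ^ d / 2` when `n = d`, so the average cost is at least
`(d + 1) * d ^ d / 6`. Averaging over the algorithm's randomness as well (Yao's principle) gives `c
= 1 / 6`. -/

noncomputable section

namespace UnitClustering

/-! ### Geometry of the cells, the grid and the rounds -/

/-- The offset of the cells determined by a bit, in half units. -/
def offset (b : Bool) : ℤ := if b then 2 else 0

/-- The index of the cell of length two that contains the coordinate `x`, in half units. -/
def cell (b : Bool) (x : ℤ) : ℤ := (x + offset b) / 4

/-- The integer grid, in half units. -/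
def grid (n : ℕ) : Finset ℤ := (Finset.range (2 * n - 1)).image fun a : ℕ => 2 * (a : ℤ)

/-- The midpoints of the cells, in half units. -/
def midpoints (n : ℕ) (b : Bool) : Finset ℤ :=
  (Finset.range n).image fun k : ℕ => 4 * (k : ℤ) - offset b + 1

/-- The points of round `i`: the first `i` coordinates are midpoints of cells, the others lie in
the integer grid. -/
def roundPts {d : ℕ} (n i : ℕ) (v : Fin d → Bool) : Finset (Fin d → ℤ) :=
  Fintype.piFinset fun j => if (j : ℕ) < i then midpoints n (v j) else grid n

/-- The points of the rounds `0, …, i`. -/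
def pointsUpTo {d : ℕ} (n i : ℕ) (v : Fin d → Bool) : Finset (Fin d → ℤ) :=
  (Finset.range (i + 1)).biUnion fun k => roundPts n k v

lemma mem_grid {n : ℕ} {x : ℤ} : x ∈ grid n ↔ ∃ a : ℕ, a < 2 * n - 1 ∧ 2 * (a : ℤ) = x := by
  simp [grid]

lemma mem_midpoints {n : ℕ} {b : Bool} {x : ℤ} :
    x ∈ midpoints n b ↔ ∃ k : ℕ, k < n ∧ 4 * (k : ℤ) - offset b + 1 = x := by
  simp [midpoints]

lemma card_grid (n : ℕ) : (grid n).card = 2 * n - 1 := by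
  rw [grid, Finset.card_image_of_injective, Finset.card_range]
  intro a b h
  simpa using h

lemma card_midpoints (n : ℕ) (b : Bool) : (midpoints n b).card = n := by
  rw [midpoints, Finset.card_image_of_injective, Finset.card_range]
  intro a b h
  simpa using h

lemma mem_roundPts {d n i : ℕ} {v : Fin d → Bool} {x : Fin d → ℤ} :
    x ∈ roundPts n i v ↔
      ∀ j : Fin d, x j ∈ if (j : ℕ) < i then midpoints n (v j) else grid n := by
  simp [roundPts]

lemma mem_pointsUpTo {d n i : ℕ} {v : Fin d → Bool} {x : Fin d → ℤ} :
    x ∈ pointsUpTo n i v ↔ ∃ k ≤ i, x ∈ roundPts n k v := by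
  simp [pointsUpTo]

lemma pointsUpTo_mono {d n i k : ℕ} (h : i ≤ k) (v : Fin d → Bool) :
    pointsUpTo n i v ⊆ pointsUpTo n k v := by
  intro x hx
  obtain ⟨l, hl, hx⟩ := mem_pointsUpTo.1 hx
  exact mem_pointsUpTo.2 ⟨l, hl.trans h, hx⟩

lemma roundPts_congr {d n i : ℕ} {v v' : Fin d → Bool} (h : ∀ j : Fin d, (j : ℕ) < i → v j = v' j) :
    roundPts n i v = roundPts n i v' := by
  unfold roundPts
  congr 1
  funext j
  split_ifs with hj
  · rw [h j hj]
  · rfl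

lemma pointsUpTo_congr {d n i : ℕ} {v v' : Fin d → Bool}
    (h : ∀ j : Fin d, (j : ℕ) < i → v j = v' j) : pointsUpTo n i v = pointsUpTo n i v' := by
  unfold pointsUpTo
  refine Finset.biUnion_congr rfl fun k hk => roundPts_congr fun j hj => h j ?_
  have := Finset.mem_range.1 hk
  omega

lemma coord_mem {d n i : ℕ} {v : Fin d → Bool} {x : Fin d → ℤ} (hx : x ∈ pointsUpTo n i v)
    (j : Fin d) : x j ∈ midpoints n (v j) ∨ x j ∈ grid n := by
  obtain ⟨k, -, hx⟩ := mem_pointsUpTo.1 hx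
  have := mem_roundPts.1 hx j
  split_ifs at this
  exacts [Or.inl this, Or.inr this]

lemma coord_mem_grid {d n i : ℕ} {v : Fin d → Bool} {x : Fin d → ℤ} (hx : x ∈ pointsUpTo n i v)
    {j : Fin d} (hj : i ≤ j) : x j ∈ grid n := by
  obtain ⟨k, hk, hx⟩ := mem_pointsUpTo.1 hx
  have := mem_roundPts.1 hx j
  rwa [if_neg (by omega)] at this

/-- Coordinate `i` is even in round `i` and odd in every later round. This makes the input free of
repetitions. -/
lemma roundPts_disjoint {d n i k : ℕ} (hik : i < k) (hk : k ≤ d) (v : Fin d → Bool) :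
    Disjoint (roundPts n i v) (roundPts n k v) := by
  rw [Finset.disjoint_left]
  intro x hx hx'
  have h1 := mem_roundPts.1 hx ⟨i, by omega⟩
  have h2 := mem_roundPts.1 hx' ⟨i, by omega⟩
  simp only [lt_irrefl, if_false, hik, if_true] at h1 h2
  obtain ⟨a, -, ha⟩ := mem_grid.1 h1
  obtain ⟨b, -, hb⟩ := mem_midpoints.1 h2
  unfold offset at hb
  split_ifs at hb <;> omega

/-- Coordinates in the same cell differ by at most one unit. -/
lemma abs_sub_le_of_cell_eq {n : ℕ} {b : Bool} {x y : ℤ} (hx : x ∈ midpoints n b ∨ x ∈ grid n)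
    (hy : y ∈ midpoints n b ∨ y ∈ grid n) (h : cell b x = cell b y) : |x - y| ≤ 2 := by
  rw [mem_midpoints, mem_grid] at hx hy
  rw [abs_le]
  unfold cell at h
  unfold offset at *
  rcases hx with ⟨k, -, hx⟩ | ⟨k, -, hx⟩ <;> rcases hy with ⟨l, -, hy⟩ | ⟨l, -, hy⟩ <;>
    split_ifs at * <;> omega

lemma cell_mem {n : ℕ} {b : Bool} {x : ℤ} (hx : x ∈ midpoints n b ∨ x ∈ grid n) :
    cell b x ∈ (Finset.range n).image fun k : ℕ => (k : ℤ) := by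
  rw [mem_midpoints, mem_grid] at hx
  have : 0 ≤ cell b x ∧ cell b x < n := by
    unfold cell
    unfold offset at *
    rcases hx with ⟨k, hk, hx⟩ | ⟨k, hk, hx⟩ <;> split_ifs at * <;> omega
  exact Finset.mem_image.2 ⟨(cell b x).toNat, by simp; omega, by simp; omega⟩

/-- A coordinate at distance at most one unit from the midpoint of a cell is in that cell. -/
lemma cell_eq_of_midpoint {n : ℕ} {b : Bool} {x y : ℤ} (hx : x ∈ midpoints n b)
    (hy : y ∈ midpoints n b ∨ y ∈ grid n) (h : |x - y| ≤ 2) : cell b x = cell b y := by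
  rw [mem_midpoints] at hx
  rw [mem_midpoints, mem_grid] at hy
  rw [abs_le] at h
  unfold cell
  unfold offset at *
  obtain ⟨k, -, hx⟩ := hx
  rcases hy with ⟨l, -, hy⟩ | ⟨l, -, hy⟩ <;> split_ifs at * <;> omega

/-- Midpoints for the same bit are spaced 4 half units apart. -/
lemma midpoint_eq {n : ℕ} {b : Bool} {x y : ℤ} (hx : x ∈ midpoints n b)
    (hy : y ∈ midpoints n b) (h : |x - y| ≤ 2) : x = y := by
  rw [mem_midpoints] at hx hy
  rw [abs_le] at h
  obtain ⟨k, -, hx⟩ := hx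
  obtain ⟨l, -, hy⟩ := hy
  omega

/-- Two grid coordinates at distance one are separated by one of the two systems of cells. -/
lemma exists_cell_ne {n : ℕ} {x y : ℤ} (hx : x ∈ grid n) (hy : y ∈ grid n) (hne : x ≠ y)
    (h : |x - y| ≤ 2) (b : Bool) : cell b x ≠ cell b y ∨ cell (!b) x ≠ cell (!b) y := by
  rw [mem_grid] at hx hy
  rw [abs_le] at h
  obtain ⟨k, -, hx⟩ := hx
  obtain ⟨l, -, hy⟩ := hy
  unfold cell offset
  cases b <;> simp <;> omega

lemma card_le_two {n : ℕ} {s : Finset ℤ} (hs : s ⊆ grid n)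
    (h : ∀ x ∈ s, ∀ y ∈ s, |x - y| ≤ 2) : s.card ≤ 2 := by
  rcases s.eq_empty_or_nonempty with rfl | hne
  · simp
  -- Grid values are even, so only the minimum and its successor fit within 2 half units.
  refine (Finset.card_le_card (t := {s.min' hne, s.min' hne + 2}) fun x hx => ?_).trans
    Finset.card_le_two
  have h1 := s.min'_le x hx
  have h2 := h x hx _ (s.min'_mem hne)
  obtain ⟨a, -, ha⟩ := mem_grid.1 (hs hx)
  obtain ⟨b, -, hb⟩ := mem_grid.1 (hs (s.min'_mem hne))
  rw [abs_le] at h2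
  simp only [Finset.mem_insert, Finset.mem_singleton]
  omega

/-- An online labelling of the random input: it makes unit clusters, and the label of a point is
determined by the bits revealed when it arrives. -/
structure IsOnlineLabelling {d : ℕ} (n : ℕ) (lab : (Fin d → Bool) → (Fin d → ℤ) → ℕ) : Prop where
  close : ∀ v, ∀ x ∈ pointsUpTo n d v, ∀ y ∈ pointsUpTo n d v, lab v x = lab v y →
    ∀ j, |x j - y j| ≤ 2
  congr : ∀ v v' : Fin d → Bool, ∀ i ≤ d, (∀ j : Fin d, (j : ℕ) < i → v j = v' j) →
    ∀ x ∈ pointsUpTo n i v, lab v x = lab v' x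

/-! ### The potential argument for a single label -/

section Potential

variable {d : ℕ}

/-- The cluster with label `l` at the end of round `i`. -/
def cluster (n : ℕ) (lab : (Fin d → Bool) → (Fin d → ℤ) → ℕ) (v : Fin d → Bool) (i l : ℕ) :
    Finset (Fin d → ℤ) :=
  (pointsUpTo n i v).filter fun x => lab v x = l

/-- The fraction of the grid points of a unit cube that fit into the extent of `Q`, with respect to
the coordinates from `i` on. -/
def extent (i : ℕ) (Q : Finset (Fin d → ℤ)) : ℝ :=
  ∏ j : Fin d, if (j : ℕ) < i then 1 else ((Q.image fun x => x j).card : ℝ) / 2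

/-- The reciprocal of the number of points of round `i` in a unit cube. -/
def weight (d i : ℕ) : ℝ := ∏ j : Fin d, if (j : ℕ) < i then 1 else 1 / 2

/-- `Q` is contained in one cell with respect to each of the first `i` coordinates. -/
def Alive (v : Fin d → Bool) (i : ℕ) (Q : Finset (Fin d → ℤ)) : Prop :=
  ∀ j : Fin d, (j : ℕ) < i → ∀ x ∈ Q, ∀ y ∈ Q, cell (v j) (x j) = cell (v j) (y j)

open Classical in
/-- The potential of a cluster at the end of round `i`. -/
def potential (v : Fin d → Bool) (i : ℕ) (Q : Finset (Fin d → ℤ)) : ℝ :=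
  if Q = ∅ then 0 else if Alive v i Q then 2 * extent i Q else 3

/-- The weight of the points of round `i` in `Q`. -/
def load (n : ℕ) (v : Fin d → Bool) (i : ℕ) (Q : Finset (Fin d → ℤ)) : ℝ :=
  ((Q ∩ roundPts n i v).card : ℝ) * weight d i

lemma Alive.mono {v : Fin d → Bool} {i k : ℕ} {Q Q' : Finset (Fin d → ℤ)} (h : Alive v k Q')
    (hik : i ≤ k) (hQ : Q ⊆ Q') : Alive v i Q :=
  fun j hj x hx y hy => h j (hj.trans_le hik) x (hQ hx) y (hQ hy)

lemma weight_pos (d i : ℕ) : 0 < weight d i := by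
  unfold weight
  refine Finset.prod_pos fun j _ => ?_
  split_ifs <;> norm_num

lemma extent_nonneg (i : ℕ) (Q : Finset (Fin d → ℤ)) : 0 ≤ extent i Q := by
  unfold extent
  refine Finset.prod_nonneg fun j _ => ?_
  split_ifs <;> positivity

variable {n : ℕ} {lab : (Fin d → Bool) → (Fin d → ℤ) → ℕ} {v : Fin d → Bool} {i l : ℕ}

lemma mem_cluster {x : Fin d → ℤ} :
    x ∈ cluster n lab v i l ↔ x ∈ pointsUpTo n i v ∧ lab v x = l := by
  simp [cluster]

lemma cluster_mono {k : ℕ} (h : i ≤ k) : cluster n lab v i l ⊆ cluster n lab v k l :=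
  Finset.filter_subset_filter _ (pointsUpTo_mono h v)

lemma IsOnlineLabelling.close_of_mem (H : IsOnlineLabelling n lab) (hi : i ≤ d)
    {x y : Fin d → ℤ} (hx : x ∈ cluster n lab v i l) (hy : y ∈ cluster n lab v i l) (j : Fin d) :
    |x j - y j| ≤ 2 := by
  rw [mem_cluster] at hx hy
  exact H.close v x (pointsUpTo_mono hi v hx.1) y (pointsUpTo_mono hi v hy.1)
    (hx.2.trans hy.2.symm) j

lemma IsOnlineLabelling.cluster_congr (H : IsOnlineLabelling n lab) (hi : i ≤ d)
    {v' : Fin d → Bool} (h : ∀ j : Fin d, (j : ℕ) < i → v j = v' j) :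
    cluster n lab v i l = cluster n lab v' i l := by
  unfold cluster
  rw [← pointsUpTo_congr h]
  refine Finset.filter_congr fun x hx => ?_
  rw [H.congr v v' i hi h x hx]

lemma IsOnlineLabelling.card_image_le (H : IsOnlineLabelling n lab) (hi : i ≤ d) {j : Fin d}
    (hj : i ≤ j) : ((cluster n lab v i l).image fun x => x j).card ≤ 2 := by
  refine card_le_two (n := n) (fun a ha => ?_) fun a ha b hb => ?_
  · obtain ⟨x, hx, rfl⟩ := Finset.mem_image.1 ha
    exact coord_mem_grid (mem_cluster.1 hx).1 hj
  · obtain ⟨x, hx, rfl⟩ := Finset.mem_image.1 ha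
    obtain ⟨y, hy, rfl⟩ := Finset.mem_image.1 hb
    exact H.close_of_mem hi hx hy j

lemma IsOnlineLabelling.extent_le_one (H : IsOnlineLabelling n lab) (hi : i ≤ d) :
    extent i (cluster n lab v i l) ≤ 1 := by
  unfold extent
  refine Finset.prod_le_one (fun j _ => ?_) fun j _ => ?_
  · split_ifs <;> positivity
  · split_ifs with hj
    · exact le_rfl
    · have : (((cluster n lab v i l).image fun x => x j).card : ℝ) ≤ 2 := by
        exact_mod_cast H.card_image_le hi (not_lt.1 hj)
      linarith

/-- The points of round `i` in one cluster share their first `i` coordinates, since distinct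
midpoints are too far apart. They lie in the product of the remaining projections, and `weight`
supplies the factors 1/2 of `extent`. -/
lemma IsOnlineLabelling.load_le_extent (H : IsOnlineLabelling n lab) (hi : i ≤ d) :
    load n v i (cluster n lab v i l) ≤ extent i (cluster n lab v i l) := by
  set Q := cluster n lab v i l with hQ
  rcases (Q ∩ roundPts n i v).eq_empty_or_nonempty with h0 | ⟨z, hz⟩
  · simp [load, h0, extent_nonneg]
  have hsub : Q ∩ roundPts n i v ⊆
      Fintype.piFinset fun j => if (j : ℕ) < i then {z j} else Q.image fun x => x j := by
    intro x hx
    rw [Finset.mem_inter] at hx hz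
    rw [Fintype.mem_piFinset]
    intro j
    split_ifs with hj
    · have h1 := mem_roundPts.1 hx.2 j
      have h2 := mem_roundPts.1 hz.2 j
      rw [if_pos hj] at h1 h2
      exact Finset.mem_singleton.2 (midpoint_eq h1 h2 (H.close_of_mem hi hx.1 hz.1 j))
    · exact Finset.mem_image_of_mem _ hx.1
  have hcard := Finset.card_le_card hsub
  rw [Fintype.card_piFinset] at hcard
  have hcard' : ((Q ∩ roundPts n i v).card : ℝ) ≤
      ∏ j : Fin d, ((if (j : ℕ) < i then {z j} else Q.image fun x => x j : Finset ℤ).card : ℝ) := by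
    exact_mod_cast hcard
  refine (mul_le_mul_of_nonneg_right hcard' (weight_pos d i).le).trans_eq ?_
  rw [weight, extent, ← Finset.prod_mul_distrib]
  refine Finset.prod_congr rfl fun j _ => ?_
  split_ifs
  · simp
  · ring

/-- A midpoint is within one unit only of coordinates in its own cell, so a single point of round
`i` forces the whole cluster into its cells. -/
lemma IsOnlineLabelling.alive_of_mem (H : IsOnlineLabelling n lab) (hi : i ≤ d) {z : Fin d → ℤ}
    (hz : z ∈ cluster n lab v i l) (hz' : z ∈ roundPts n i v) :
    Alive v i (cluster n lab v i l) := by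
  intro j hj
  have h2 := mem_roundPts.1 hz' j
  rw [if_pos hj] at h2
  have key : ∀ x ∈ cluster n lab v i l, cell (v j) (z j) = cell (v j) (x j) := fun x hx =>
    cell_eq_of_midpoint h2 (coord_mem (mem_cluster.1 hx).1 j) (H.close_of_mem hi hz hx j)
  intro x hx y hy
  rw [← key x hx, ← key y hy]

lemma IsOnlineLabelling.load_eq_zero (H : IsOnlineLabelling n lab) (hi : i ≤ d)
    (h : ¬ Alive v i (cluster n lab v i l)) : load n v i (cluster n lab v i l) = 0 := by
  have : cluster n lab v i l ∩ roundPts n i v = ∅ := by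
    rw [Finset.eq_empty_iff_forall_notMem]
    intro z hz
    rw [Finset.mem_inter] at hz
    exact h (H.alive_of_mem hi hz.1 hz.2)
  simp [load, this]

lemma IsOnlineLabelling.potential_sub_load_of_not_alive (H : IsOnlineLabelling n lab) (hi : i ≤ d)
    (h : ¬ Alive v i (cluster n lab v i l)) :
    potential v i (cluster n lab v i l) - load n v i (cluster n lab v i l) = 3 := by
  rw [H.load_eq_zero hi h, potential, if_neg, if_neg h, sub_zero]
  intro h0
  rw [h0] at h
  exact h fun j _ x hx => by simp at hx

/-- The factor 2 in `potential` is used here: after paying the load, which is at most one extent, an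
alive cluster retains another. -/
lemma IsOnlineLabelling.extent_le_potential_sub_load (H : IsOnlineLabelling n lab) (hi : i ≤ d)
    (hne : (cluster n lab v i l).Nonempty) :
    extent i (cluster n lab v i l) ≤
      potential v i (cluster n lab v i l) - load n v i (cluster n lab v i l) := by
  by_cases h : Alive v i (cluster n lab v i l)
  · have := H.load_le_extent hi (v := v) (l := l)
    rw [potential, if_neg hne.ne_empty, if_pos h]
    linarith
  · rw [H.potential_sub_load_of_not_alive hi h]
    linarith [H.extent_le_one hi (v := v) (l := l)]

lemma IsOnlineLabelling.load_le_potential (H : IsOnlineLabelling n lab) (hi : i ≤ d) :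
    load n v i (cluster n lab v i l) ≤ potential v i (cluster n lab v i l) := by
  rcases (cluster n lab v i l).eq_empty_or_nonempty with h0 | hne
  · simp [h0, load, potential]
  · linarith [H.extent_le_potential_sub_load hi hne, extent_nonneg i (cluster n lab v i l)]

lemma IsOnlineLabelling.potential_le (H : IsOnlineLabelling n lab) (hi : i ≤ d) :
    potential v i (cluster n lab v i l) ≤ if (cluster n lab v i l).Nonempty then 3 else 0 := by
  rw [potential]
  rcases (cluster n lab v i l).eq_empty_or_nonempty with h0 | hne
  · simp [h0]
  rw [if_neg hne.ne_empty, if_pos hne]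
  split_ifs
  · linarith [H.extent_le_one hi (v := v) (l := l)]
  · exact le_rfl

lemma extent_succ_mono {Q Q' : Finset (Fin d → ℤ)} (h : Q ⊆ Q') :
    extent (i + 1) Q ≤ extent (i + 1) Q' := by
  unfold extent
  refine Finset.prod_le_prod (fun j _ => ?_) fun j _ => ?_
  · split_ifs <;> positivity
  · split_ifs
    · exact le_rfl
    · have : ((Q.image fun x => x j).card : ℝ) ≤ (Q'.image fun x => x j).card := by
        exact_mod_cast Finset.card_le_card (Finset.image_subset_image h)
      linarith

lemma extent_eq_mul (hi : i < d) (Q : Finset (Fin d → ℤ)) :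
    extent i Q = ((Q.image fun x => x ⟨i, hi⟩).card : ℝ) / 2 * extent (i + 1) Q := by
  unfold extent
  rw [← Finset.mul_prod_erase _ _ (Finset.mem_univ (⟨i, hi⟩ : Fin d)),
    ← Finset.mul_prod_erase _ (fun j : Fin d => if (j : ℕ) < i + 1 then (1 : ℝ) else _)
      (Finset.mem_univ (⟨i, hi⟩ : Fin d))]
  simp only [lt_irrefl, if_false, Nat.lt_succ_self, if_true, one_mul]
  congr 1
  refine Finset.prod_congr rfl fun j hj => ?_
  have : (j : ℕ) ≠ i := fun h => (Finset.mem_erase.1 hj).1 (Fin.ext h)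
  congr 1
  exact propext ⟨fun h => by omega, fun h => by omega⟩

/-- Revealing the bit `i` and serving the next round: on average, the potential of a cluster grows
at least by the load it receives. -/
lemma IsOnlineLabelling.potential_step (H : IsOnlineLabelling n lab) (hi : i < d)
    {v' : Fin d → Bool} (hv' : v' = Function.update v ⟨i, hi⟩ (!v ⟨i, hi⟩)) :
    2 * potential v i (cluster n lab v i l) ≤
      (potential v (i + 1) (cluster n lab v (i + 1) l) -
        load n v (i + 1) (cluster n lab v (i + 1) l)) +
      (potential v' (i + 1) (cluster n lab v' (i + 1) l) -
        load n v' (i + 1) (cluster n lab v' (i + 1) l)) := by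
  have hagree : ∀ j : Fin d, (j : ℕ) < i → v j = v' j := by
    intro j hj
    rw [hv', Function.update_of_ne]
    rintro rfl
    exact lt_irrefl _ hj
  have hcl : cluster n lab v i l = cluster n lab v' i l := H.cluster_congr hi.le hagree
  have hsub : cluster n lab v i l ⊆ cluster n lab v (i + 1) l := cluster_mono (Nat.le_succ i)
  have hsub' : cluster n lab v i l ⊆ cluster n lab v' (i + 1) l :=
    hcl ▸ cluster_mono (Nat.le_succ i)
  have hi' : i + 1 ≤ d := hi
  rcases (cluster n lab v i l).eq_empty_or_nonempty with h0 | hne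
  -- The label may first appear in the next round; its new potential still covers its load.
  · rw [h0, potential, if_pos rfl]
    linarith [H.load_le_potential hi' (v := v) (l := l),
      H.load_le_potential hi' (v := v') (l := l)]
  by_cases hal : Alive v i (cluster n lab v i l)
  swap
  · have h1 : ¬ Alive v (i + 1) (cluster n lab v (i + 1) l) :=
      fun h => hal (h.mono (Nat.le_succ i) hsub)
    have h2 : ¬ Alive v' (i + 1) (cluster n lab v' (i + 1) l) := fun h =>
      hal fun j hj x hx y hy => by
        rw [hagree j hj]
        exact h.mono (Nat.le_succ i) hsub' j hj x hx y hy
    rw [H.potential_sub_load_of_not_alive hi' h1, H.potential_sub_load_of_not_alive hi' h2,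
      potential, if_neg hne.ne_empty, if_neg hal]
    norm_num
  have e1 := H.extent_le_potential_sub_load hi' (hne.mono hsub)
  have e2 := H.extent_le_potential_sub_load hi' (hne.mono hsub')
  have m1 := extent_succ_mono (i := i) hsub
  have m2 := extent_succ_mono (i := i) hsub'
  have hle := H.card_image_le hi.le (v := v) (l := l) (j := ⟨i, hi⟩) le_rfl
  have hone := H.extent_le_one hi.le (v := v) (l := l)
  have hmul := extent_eq_mul hi (cluster n lab v i l)
  have hpos : 0 < ((cluster n lab v i l).image fun x => x ⟨i, hi⟩).card :=
    (hne.image _).card_pos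
  rw [potential, if_neg hne.ne_empty, if_pos hal]
  -- Width one: the extent doubles when factor `i` is dropped, so each branch retains at least twice
  -- the old extent, which is exactly enough.
  by_cases hc : ((cluster n lab v i l).image fun x => x ⟨i, hi⟩).card = 1
  · rw [hc] at hmul
    push_cast at hmul
    linarith
  have hc2 : ((cluster n lab v i l).image fun x => x ⟨i, hi⟩).card = 2 := by omega
  rw [hc2] at hmul
  push_cast at hmul
  obtain ⟨a, ha, b, hb, hab⟩ := Finset.one_lt_card.1 (hc2 ▸ one_lt_two)
  obtain ⟨x, hx, rfl⟩ := Finset.mem_image.1 ha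
  obtain ⟨y, hy, rfl⟩ := Finset.mem_image.1 hb
  have hgx := coord_mem_grid (mem_cluster.1 hx).1 (j := ⟨i, hi⟩) le_rfl
  have hgy := coord_mem_grid (mem_cluster.1 hy).1 (j := ⟨i, hi⟩) le_rfl
  -- Width two: the extent `e` is unchanged by dropping factor `i`. One of the two bits kills the
  -- cluster, leaving 3, and the other branch retains at least `e`. Since `e ≤ 1`, `3 + e ≥ 4 * e`;
  -- this fixes the constant 3.
  rcases exists_cell_ne hgx hgy hab (H.close_of_mem hi.le hx hy _) (v ⟨i, hi⟩) with h | h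
  · have h1 : ¬ Alive v (i + 1) (cluster n lab v (i + 1) l) := fun h' =>
      h (h' ⟨i, hi⟩ (Nat.lt_succ_self i) x (hsub hx) y (hsub hy))
    rw [H.potential_sub_load_of_not_alive hi' h1] at e1 ⊢
    linarith
  · have h1 : ¬ Alive v' (i + 1) (cluster n lab v' (i + 1) l) := fun h' => by
      have := h' ⟨i, hi⟩ (Nat.lt_succ_self i) x (hsub' hx) y (hsub' hy)
      rw [hv', Function.update_self] at this
      exact h this
    rw [H.potential_sub_load_of_not_alive hi' h1] at e2 ⊢
    linarith

/-- Flipping bit `i` is an involution on the bit vectors, so summing `potential_step` over all `v`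
counts every branch twice. -/
lemma IsOnlineLabelling.sum_potential_step (H : IsOnlineLabelling n lab) (hi : i < d) :
    ∑ v, potential v i (cluster n lab v i l) +
        ∑ v, load n v (i + 1) (cluster n lab v (i + 1) l) ≤
      ∑ v, potential v (i + 1) (cluster n lab v (i + 1) l) := by
  have hinv : Function.Involutive fun v : Fin d → Bool =>
      Function.update v ⟨i, hi⟩ (!v ⟨i, hi⟩) := by
    intro v
    simp
  have h1 := Finset.sum_le_sum fun v (_ : v ∈ Finset.univ) =>
    H.potential_step (l := l) hi (v := v) rfl
  have h2 := Equiv.sum_comp hinv.toPerm fun v => potential v (i + 1) (cluster n lab v (i + 1) l) -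
    load n v (i + 1) (cluster n lab v (i + 1) l)
  simp only [Function.Involutive.coe_toPerm] at h2
  rw [Finset.sum_add_distrib, h2, ← Finset.mul_sum, Finset.sum_sub_distrib] at h1
  linarith

lemma IsOnlineLabelling.sum_load_le (H : IsOnlineLabelling n lab) (hi : i ≤ d) :
    ∑ k ∈ Finset.range (i + 1), ∑ v, load n v k (cluster n lab v k l) ≤
      ∑ v, potential v i (cluster n lab v i l) := by
  induction i with
  | zero =>
    rw [zero_add, Finset.sum_range_one]
    exact Finset.sum_le_sum fun v _ => H.load_le_potential hi
  | succ i ih =>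
    rw [Finset.sum_range_succ]
    linarith [ih (Nat.le_of_succ_le hi), H.sum_potential_step (l := l) hi]

end Potential

/-! ### Total weight of a round and summation over labels -/

lemma weight_mul_card_roundPts {d : ℕ} (hd : 1 ≤ d) (i : ℕ) (v : Fin d → Bool) :
    (d : ℝ) ^ d / 2 ≤ (roundPts d i v).card * weight d i := by
  have hd' : (1 : ℝ) ≤ d := by exact_mod_cast hd
  have h1 : ((d : ℝ) - 1 / 2) ^ d ≤ (roundPts d i v).card * weight d i := by
    rw [roundPts, Fintype.card_piFinset, Nat.cast_prod, weight, ← Finset.prod_mul_distrib]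
    calc ((d : ℝ) - 1 / 2) ^ d = ∏ _j : Fin d, ((d : ℝ) - 1 / 2) := by simp
      _ ≤ _ := Finset.prod_le_prod (fun j _ => by linarith) fun j _ => ?_
    split_ifs
    · rw [card_midpoints]
      linarith
    · rw [card_grid, Nat.cast_sub (by omega)]
      push_cast
      linarith
  -- Bernoulli's inequality: taking `n = d` keeps the boundary loss `(1 - 1 / (2 * d)) ^ d` above
  -- 1/2.
  have h2 := one_add_mul_le_pow (a := -(1 / (2 * (d : ℝ)))) (by
    have : 1 / (2 * (d : ℝ)) ≤ 1 := by
      rw [div_le_one (by positivity)]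
      linarith
    linarith) d
  have h3 : (1 : ℝ) + d * -(1 / (2 * (d : ℝ))) = 1 / 2 := by
    field_simp
    norm_num
  rw [h3] at h2
  have h4 : ((d : ℝ) - 1 / 2) ^ d = (d : ℝ) ^ d * (1 + -(1 / (2 * (d : ℝ)))) ^ d := by
    rw [← mul_pow]
    congr 1
    field_simp
    ring
  rw [h4] at h1
  have h5 := mul_le_mul_of_nonneg_left h2 (by positivity : 0 ≤ (d : ℝ) ^ d)
  linarith

/-- The average number of clusters of an online labelling of the random input. -/
theorem IsOnlineLabelling.le_sum_card {d : ℕ} (hd : 1 ≤ d)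
    {lab : (Fin d → Bool) → (Fin d → ℤ) → ℕ} (H : IsOnlineLabelling d lab) :
    2 ^ d * ((d + 1 : ℝ) * (d : ℝ) ^ d / 6) ≤
      ∑ v, (((pointsUpTo d d v).image (lab v)).card : ℝ) := by
  -- One finite set of labels serves all bit vectors, so that the sums over `v` and over labels can
  -- be exchanged.
  set L : Finset ℕ := Finset.univ.biUnion fun v => (pointsUpTo d d v).image (lab v) with hL
  have hlab : ∀ v, ∀ x ∈ pointsUpTo d d v, lab v x ∈ L := fun v x hx =>
    Finset.mem_biUnion.2 ⟨v, Finset.mem_univ v, Finset.mem_image_of_mem _ hx⟩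
  have hload : ∀ v, ∀ k ∈ Finset.range (d + 1),
      (d : ℝ) ^ d / 2 ≤ ∑ l ∈ L, load d v k (cluster d lab v k l) := by
    intro v k hk
    have hk' : k ≤ d := Nat.lt_succ_iff.1 (Finset.mem_range.1 hk)
    refine (weight_mul_card_roundPts hd k v).trans_eq ?_
    unfold load
    rw [← Finset.sum_mul, ← Nat.cast_sum]
    congr 2
    rw [Finset.card_eq_sum_card_fiberwise (f := lab v) (t := L)]
    · refine Finset.sum_congr rfl fun l _ => congrArg Finset.card ?_
      ext x
      simp only [Finset.mem_filter, Finset.mem_inter, mem_cluster]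
      constructor
      · rintro ⟨h1, h2⟩
        exact ⟨⟨mem_pointsUpTo.2 ⟨k, le_rfl, h1⟩, h2⟩, h1⟩
      · rintro ⟨⟨-, h2⟩, h1⟩
        exact ⟨h1, h2⟩
    · intro x hx
      exact hlab v x (mem_pointsUpTo.2 ⟨k, hk', hx⟩)
  have hpot : ∀ v, ∑ l ∈ L, potential v d (cluster d lab v d l) ≤
      3 * (((pointsUpTo d d v).image (lab v)).card : ℝ) := by
    intro v
    refine (Finset.sum_le_sum fun l _ => H.potential_le le_rfl).trans ?_
    rw [← Finset.sum_filter, Finset.sum_const, nsmul_eq_mul, mul_comm]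
    refine mul_le_mul_of_nonneg_left ?_ (by norm_num)
    rw [Nat.cast_le]
    refine Finset.card_le_card fun l hl => ?_
    obtain ⟨x, hx⟩ := (Finset.mem_filter.1 hl).2
    exact Finset.mem_image.2 ⟨x, (mem_cluster.1 hx).1, (mem_cluster.1 hx).2⟩
  have h1 : ∑ v : Fin d → Bool, ∑ _k ∈ Finset.range (d + 1), (d : ℝ) ^ d / 2 ≤
      ∑ v, ∑ k ∈ Finset.range (d + 1), ∑ l ∈ L, load d v k (cluster d lab v k l) :=
    Finset.sum_le_sum fun v _ => Finset.sum_le_sum (hload v)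
  have h2 : ∑ l ∈ L, ∑ k ∈ Finset.range (d + 1), ∑ v, load d v k (cluster d lab v k l) ≤
      ∑ l ∈ L, ∑ v, potential v d (cluster d lab v d l) :=
    Finset.sum_le_sum fun l _ => H.sum_load_le le_rfl
  have h3 : ∑ v, ∑ k ∈ Finset.range (d + 1), ∑ l ∈ L, load d v k (cluster d lab v k l) =
      ∑ l ∈ L, ∑ k ∈ Finset.range (d + 1), ∑ v, load d v k (cluster d lab v k l) := by
    rw [Finset.sum_comm]
    rw [Finset.sum_comm (s := L)]
    exact Finset.sum_congr rfl fun k _ => Finset.sum_comm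
  have h4 : ∑ l ∈ L, ∑ v, potential v d (cluster d lab v d l) ≤
      ∑ v, 3 * (((pointsUpTo d d v).image (lab v)).card : ℝ) := by
    rw [Finset.sum_comm]
    exact Finset.sum_le_sum fun v _ => hpot v
  rw [← Finset.mul_sum] at h4
  simp only [Finset.sum_const, Finset.card_univ, Fintype.card_fun, Fintype.card_bool,
    Fintype.card_fin, Finset.card_range, nsmul_eq_mul] at h1
  push_cast at h1
  linarith

/-! ### The hard input as a list of real points -/

/-- The point with coordinates `x` in half units. -/
def toPoint {d : ℕ} (x : Fin d → ℤ) : Point d := fun j => (x j : ℝ) / 2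

lemma toPoint_injective {d : ℕ} : Function.Injective (toPoint (d := d)) := by
  intro x y h
  funext j
  have := congrFun h j
  simp only [toPoint] at this
  have h' : (x j : ℝ) = y j := by linarith
  exact_mod_cast h'

lemma dist_toPoint_le_one {d : ℕ} {x y : Fin d → ℤ} :
    dist (toPoint x) (toPoint y) ≤ 1 ↔ ∀ j, |x j - y j| ≤ 2 := by
  rw [dist_pi_le_iff zero_le_one]
  refine forall_congr' fun j => ?_
  rw [Real.dist_eq, toPoint, toPoint, ← sub_div, abs_div, abs_two, div_le_one two_pos]
  rw [← Int.cast_sub, ← Int.cast_abs]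
  norm_cast

/-- The rounds `0, …, i` in order. -/
def rounds {d : ℕ} (n i : ℕ) (v : Fin d → Bool) : List (Fin d → ℤ) :=
  (List.range (i + 1)).flatMap fun k => (roundPts n k v).toList

/-- The random input. -/
def hardInput {d : ℕ} (n : ℕ) (v : Fin d → Bool) : List (Point d) := (rounds n d v).map toPoint

section

variable {d n i : ℕ} {v : Fin d → Bool}

lemma mem_rounds {x : Fin d → ℤ} : x ∈ rounds n i v ↔ x ∈ pointsUpTo n i v := by
  simp [rounds, pointsUpTo]

lemma rounds_prefix {k : ℕ} (h : i ≤ k) : rounds n i v <+: rounds n k v := by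
  induction k, h using Nat.le_induction with
  | base => exact List.prefix_rfl
  | succ k _ ih =>
    refine ih.trans ?_
    rw [rounds, rounds, List.range_succ (n := k + 1), List.flatMap_append]
    exact List.prefix_append _ _

lemma rounds_congr {v' : Fin d → Bool} (h : ∀ j : Fin d, (j : ℕ) < i → v j = v' j) :
    rounds n i v = rounds n i v' := by
  unfold rounds
  refine List.flatMap_congr fun k hk => ?_
  rw [List.mem_range] at hk
  rw [roundPts_congr fun j hj => h j (by omega)]

lemma nodup_rounds (hi : i ≤ d) : (rounds n i v).Nodup := by
  rw [rounds, List.nodup_flatMap]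
  refine ⟨fun k _ => Finset.nodup_toList _, ?_⟩
  refine (List.pairwise_lt_range (n := i + 1)).imp_of_mem fun {a b} _ hb hab => ?_
  rw [List.mem_range] at hb
  intro x hx hx'
  rw [Finset.mem_toList] at hx hx'
  exact Finset.disjoint_left.1 (roundPts_disjoint hab (by omega) v) hx hx'

lemma roundPts_nonempty (hn : 1 ≤ n) : (roundPts n i v).Nonempty := by
  rw [roundPts, Fintype.piFinset_nonempty]
  intro j
  rw [← Finset.card_pos]
  split_ifs
  · rw [card_midpoints]; omega
  · rw [card_grid]; omega

lemma isInput_hardInput (hn : 1 ≤ n) : IsInput (hardInput n v) := by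
  refine ⟨?_, (nodup_rounds le_rfl).map toPoint_injective⟩
  obtain ⟨x, hx⟩ := roundPts_nonempty (i := 0) (v := v) hn
  have hx' : x ∈ rounds n d v := mem_rounds.2 (mem_pointsUpTo.2 ⟨0, Nat.zero_le _, hx⟩)
  exact List.ne_nil_of_mem (List.mem_map_of_mem hx')

lemma opt_hardInput_le : opt (hardInput n v) ≤ n ^ d := by
  set σ := hardInput n v with hσ
  have hget : ∀ a : Fin σ.length, ∃ x ∈ pointsUpTo n d v, toPoint x = σ.get a := by
    intro a
    obtain ⟨x, hx, h⟩ := List.mem_map.1 (List.get_mem σ a)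
    exact ⟨x, mem_rounds.1 hx, h⟩
  choose x hx hxσ using hget
  -- The offline solution names a cluster by its box of cells.
  let f : Fin σ.length → ℕ := fun a => Encodable.encode fun j => cell (v j) (x a j)
  have hf : IsUnitClustering σ.get f := by
    intro a b hab
    rw [← hxσ a, ← hxσ b, dist_toPoint_le_one]
    intro j
    exact abs_sub_le_of_cell_eq (coord_mem (hx a) j) (coord_mem (hx b) j)
      (congrFun (Encodable.encode_injective hab) j)
  refine (Nat.sInf_le ⟨f, hf, rfl⟩ : opt σ ≤ numClusters f).trans ?_
  have hsub : Finset.univ.image f ⊆ (Fintype.piFinset fun _ : Fin d =>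
      (Finset.range n).image fun k : ℕ => (k : ℤ)).image Encodable.encode := by
    intro l hl
    obtain ⟨a, -, rfl⟩ := Finset.mem_image.1 hl
    exact Finset.mem_image_of_mem _ (Fintype.mem_piFinset.2 fun j => cell_mem (coord_mem (hx a) j))
  refine (Finset.card_le_card hsub).trans (Finset.card_image_le.trans ?_)
  rw [Fintype.card_piFinset, Finset.prod_const, Finset.card_univ, Fintype.card_fin]
  exact Nat.pow_le_pow_left (Finset.card_image_le.trans_eq (Finset.card_range n)) d

end

/-- What an algorithm has seen when `x` arrives depends only on the rounds up to that of `x`; this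
yields the `congr` field of `IsOnlineLabelling`. -/
lemma take_idxOf_of_prefix {α : Type*} [DecidableEq α] {l' l : List α} (h : l' <+: l) {x : α}
    (hx : x ∈ l') : l.take (l.idxOf x + 1) = l'.take (l'.idxOf x + 1) := by
  obtain ⟨t, rfl⟩ := h
  rw [List.idxOf_append_of_mem hx, List.take_append_of_le_length (List.idxOf_lt_length_of_mem hx)]

namespace OnlineAlgorithm

variable {d : ℕ} (A : OnlineAlgorithm d)

/-- The cluster of the point `x` when the algorithm serves the random input. -/
def hardLabel (n : ℕ) (v : Fin d → Bool) (x : Fin d → ℤ) : ℕ :=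
  A.assign (((rounds n d v).take ((rounds n d v).idxOf x + 1)).map toPoint)

lemma hardLabel_eq_label (n : ℕ) (v : Fin d → Bool) (x : Fin d → ℤ)
    (h : (rounds n d v).idxOf x < (hardInput n v).length) :
    A.hardLabel n v x = A.label (hardInput n v) ⟨(rounds n d v).idxOf x, h⟩ := by
  rw [hardLabel, List.map_take]
  rfl

lemma isOnlineLabelling_hardLabel {n : ℕ} (hn : 1 ≤ n) :
    IsOnlineLabelling n (A.hardLabel n) where
  close v x hx y hy hxy := by
    have hlt : ∀ z ∈ pointsUpTo n d v, (rounds n d v).idxOf z < (hardInput n v).length := by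
      intro z hz
      rw [hardInput, List.length_map]
      exact List.idxOf_lt_length_of_mem (mem_rounds.2 hz)
    have hget : ∀ z (hz : z ∈ pointsUpTo n d v),
        (hardInput n v).get ⟨(rounds n d v).idxOf z, hlt z hz⟩ = toPoint z := by
      intro z hz
      simp [hardInput]
    rw [A.hardLabel_eq_label n v x (hlt x hx), A.hardLabel_eq_label n v y (hlt y hy)] at hxy
    have := A.valid (hardInput n v) (isInput_hardInput hn) _ _ hxy
    rwa [hget x hx, hget y hy, dist_toPoint_le_one] at this
  congr v v' i hi h x hx := by
    have hx1 : x ∈ rounds n i v := mem_rounds.2 hx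
    have hx2 : x ∈ rounds n i v' := rounds_congr h ▸ hx1
    rw [hardLabel, hardLabel, take_idxOf_of_prefix (rounds_prefix hi) hx1,
      take_idxOf_of_prefix (rounds_prefix hi) hx2, rounds_congr h]

lemma cost_hardInput (n : ℕ) (v : Fin d → Bool) :
    A.cost (hardInput n v) = ((pointsUpTo n d v).image (A.hardLabel n v)).card := by
  rw [cost, numClusters]
  congr 1
  have hlen : (hardInput n v).length = (rounds n d v).length := List.length_map ..
  ext l
  simp only [Finset.mem_image, Finset.mem_univ, true_and]
  constructor
  · rintro ⟨a, rfl⟩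
    have ha : (a : ℕ) < (rounds n d v).length := hlen ▸ a.2
    refine ⟨(rounds n d v)[(a : ℕ)], mem_rounds.1 (List.getElem_mem ha), ?_⟩
    have hidx := (nodup_rounds (n := n) (v := v) le_rfl).idxOf_getElem a ha
    rw [A.hardLabel_eq_label n v _ (by rw [hidx]; exact a.2)]
    congr 1
    exact Fin.ext hidx
  · rintro ⟨x, hx, rfl⟩
    have h : (rounds n d v).idxOf x < (hardInput n v).length :=
      hlen ▸ List.idxOf_lt_length_of_mem (mem_rounds.2 hx)
    exact ⟨⟨_, h⟩, (A.hardLabel_eq_label n v x h).symm⟩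

lemma le_sum_cost (hd : 1 ≤ d) :
    2 ^ d * ((d + 1 : ℝ) * (d : ℝ) ^ d / 6) ≤
      ∑ v : Fin d → Bool, (A.cost (hardInput d v) : ℝ) := by
  simp only [cost_hardInput]
  exact (A.isOnlineLabelling_hardLabel hd).le_sum_card hd

end OnlineAlgorithm

/-! ### Averaging, and comparison of the ratios -/

namespace RandomizedAlgorithm

variable {d : ℕ} {Ω : Type*} [MeasurableSpace Ω] (R : RandomizedAlgorithm d Ω)

lemma measurable_cost (σ : List (Point d)) : Measurable fun ω => ((R.run ω).cost σ : ℝ≥0∞) := by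
  have h : Measurable fun ω => (R.run ω).label σ :=
    measurable_pi_lambda _ fun i => R.measurable_assign (σ.take (i + 1))
  exact (measurable_of_countable fun f : Fin σ.length → ℕ => (numClusters f : ℝ≥0∞)).comp h

/-- Some realization of the random input is bad for the randomized algorithm. -/
theorem exists_input_le_ratio (hd : 1 ≤ d) :
    ∃ σ : List (Point d), IsInput σ ∧
      ENNReal.ofReal (1 / 6 * d) ≤ R.expectedCost σ / (opt σ : ℝ≥0∞) := by
  have := R.isProb
  set K : ℝ := (d + 1 : ℝ) * (d : ℝ) ^ d / 6 with hK
  have hsum : ∑ _v : Fin d → Bool, ENNReal.ofReal K ≤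
      ∑ v : Fin d → Bool, R.expectedCost (hardInput d v) := by
    unfold expectedCost
    rw [← lintegral_finsetSum _ fun v _ => R.measurable_cost (hardInput d v)]
    have hpt : ∀ ω, ENNReal.ofReal (2 ^ d * K) ≤
        ∑ v : Fin d → Bool, ((R.run ω).cost (hardInput d v) : ℝ≥0∞) := by
      intro ω
      refine (ENNReal.ofReal_le_ofReal ((R.run ω).le_sum_cost hd)).trans_eq ?_
      rw [← Nat.cast_sum, ENNReal.ofReal_natCast, Nat.cast_sum]
    refine le_trans ?_ (lintegral_mono hpt)
    rw [lintegral_const, measure_univ, mul_one, ENNReal.ofReal_mul (by positivity),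
      ENNReal.ofReal_pow zero_le_two]
    simp
  -- The average over `v` is at least `K`, so some fixed `v` attains `K`.
  obtain ⟨v, hv⟩ : ∃ v, ENNReal.ofReal K ≤ R.expectedCost (hardInput d v) := by
    by_contra! h
    exact hsum.not_gt (ENNReal.sum_lt_sum_of_nonempty Finset.univ_nonempty fun v _ => h v)
  refine ⟨hardInput d v, isInput_hardInput hd, ?_⟩
  have hopt : (opt (hardInput d v) : ℝ≥0∞) ≤ ENNReal.ofReal ((d : ℝ) ^ d) := by
    rw [ENNReal.ofReal_pow (Nat.cast_nonneg d), ENNReal.ofReal_natCast]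
    exact_mod_cast opt_hardInput_le
  refine le_trans ?_ (ENNReal.div_le_div hv hopt)
  have hpos : (0 : ℝ) < (d : ℝ) ^ d := by
    have : (0 : ℝ) < d := by exact_mod_cast hd
    positivity
  rw [← ENNReal.ofReal_div_of_pos hpos]
  refine ENNReal.ofReal_le_ofReal ?_
  rw [le_div_iff₀ hpos, hK]
  linarith

lemma competitiveRatio_le_obliviousRatio : R.competitiveRatio ≤ R.obliviousRatio := by
  refine iSup₂_le fun σ hσ => ?_
  refine le_trans (le_of_eq ?_) (le_iSup _ (PMF.pure ⟨σ, hσ⟩))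
  rw [tsum_eq_single ⟨σ, hσ⟩, tsum_eq_single ⟨σ, hσ⟩]
  · simp
  all_goals
    intro τ hτ
    simp [hτ]

end RandomizedAlgorithm

namespace OnlineAlgorithm

variable {d : ℕ} (A : OnlineAlgorithm d)

/-- A deterministic algorithm as a randomized one. -/
def toRandomized : RandomizedAlgorithm d Unit where
  prob := Measure.dirac ()
  isProb := inferInstance
  run _ := A
  measurable_assign _ := measurable_const

lemma competitiveRatio_toRandomized : A.toRandomized.competitiveRatio = A.competitiveRatio := by
  simp [RandomizedAlgorithm.competitiveRatio, competitiveRatio, RandomizedAlgorithm.expectedCost,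
    toRandomized]

/-- An adversary that ignores the decisions and reads off the entry of `σ` at the transcript's
length replays `σ`. -/
lemma play_getElem? (σ : List (Point d)) (n : ℕ) :
    A.play (fun t => σ[t.length]?) n = σ.take n := by
  induction n with
  | zero => simp [play]
  | succ n ih =>
    rw [play, ih, transcript, List.length_ofFn, List.length_take, List.take_add_one]
    rcases le_total n σ.length with h | h
    · rw [min_eq_left h]
    · rw [min_eq_right h, List.getElem?_eq_none le_rfl, List.getElem?_eq_none h]

lemma competitiveRatio_le_adaptiveRatio : A.competitiveRatio ≤ A.adaptiveRatio := by
  refine iSup₂_le fun σ hσ => ?_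
  have hplay : A.play (fun t => σ[t.length]?) σ.length = σ := by
    rw [play_getElem?, List.take_length]
  refine le_iSup_of_le (fun t => σ[t.length]?) (le_iSup_of_le σ.length ?_)
  rw [hplay]
  exact le_iSup₂_of_le (by simp [transcript]) hσ le_rfl

end OnlineAlgorithm

end UnitClustering

end

theorem theorem1 :
    ∃ c : ℝ, 0 < c ∧ ∀ d : ℕ, 1 ≤ d →
      (∀ A : UnitClustering.OnlineAlgorithm d,
        ENNReal.ofReal (c * d) ≤ A.competitiveRatio ∧
        ENNReal.ofReal (c * d) ≤ A.adaptiveRatio) ∧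
      (∀ (Ω : Type*) [MeasurableSpace Ω] (R : UnitClustering.RandomizedAlgorithm d Ω),
        ENNReal.ofReal (c * d) ≤ R.competitiveRatio ∧
        ENNReal.ofReal (c * d) ≤ R.obliviousRatio) := by
  refine ⟨1 / 6, by norm_num, fun d hd => ⟨fun A => ?_, fun Ω _ R => ?_⟩⟩
  · have h : ENNReal.ofReal (1 / 6 * d) ≤ A.competitiveRatio := by
      obtain ⟨σ, hσ, h⟩ := A.toRandomized.exists_input_le_ratio hd
      rw [← A.competitiveRatio_toRandomized]
      exact le_iSup₂_of_le σ hσ h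
    exact ⟨h, h.trans A.competitiveRatio_le_adaptiveRatio⟩
  · have h : ENNReal.ofReal (1 / 6 * d) ≤ R.competitiveRatio := by
      obtain ⟨σ, hσ, h⟩ := R.exists_input_le_ratio hd
      exact le_iSup₂_of_le σ hσ h
    exact ⟨h, h.trans R.competitiveRatio_le_obliviousRatio⟩
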